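/- **Setting.** Fix a depth $L\ge 1$, an input dimension $d$, an activation $\phi:\mathbb R\to\mathbb R$ that is twice differentiable with $|\phi'|,|\phi''|$ bounded, and constants $R\ge 0$ and $\rho,\lambda,a,\mu>0$. For a width $m\ge1$ and parameters $\theta=(W^{(1)},\dots,W^{(L)},v)\in\mathbb R^p$, with $W^{(1)}\in\mathbb R^{m\times d}$, $W^{(l)}\in\mathbb R^{m\times m}$ for $2\le l\le L$, and $v\in\mathbb R^m$, the network is $$\alpha^{(0)}=x,\qquad \alpha^{(l)}=\phi\Big(\tfrac{1}{\sqrt{m_{l-1}}}W^{(l)}\alpha^{(l-1)}\Big)\ (1\le l\le L),\qquad f(\theta;x)=\tfrac1{\sqrt m}\,v^\top\alpha^{(L)},$$ where $m_0=d$ and $m_l=m$ for $l\ge1$. The initialization $\theta_0$ is random: the entries of $W^{(1)},\dots,W^{(L)}$ are independent $\mathcal N(0,1)$ variables and $v$ is a random unit vector. Write $B_\rho(\theta_0)=\{\theta:\|\theta-\theta_0\|_2\le\rho\}$. In round $t$ the data are a nonempty finite batch $\mathbf z_t=\{(x_{t,i},y_{t,i})\}_{i=1}^{n_t}$ with $\|x_{t,i}\|_2\le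 R$, and the loss is $\mathcal L(\theta;\mathbf z_t)=\frac1{n_t}\sum_{i=1}^{n_t}\ell(y_{t,i},f(\theta;x_{t,i}))$. **Theorem (regret bound under the QG condition).** There are constants $C_1,C_2,K$ and $c>0$, depending only on $L,d,\phi,R,\rho,\lambda,a,\mu$, such that for every width $m\ge1$, with probability at least $1-Ke^{-cm}$ over $\theta_0$ (that is, outside an event of probability at most $Ke^{-cm}$), the following holds simultaneously for all $T\ge2$, all loss functions $\ell$, all data $\mathbf z_1,\dots,\mathbf z_T$ as above, all parameter domains $S\subseteq\mathbb R^p$ with $B_\rho(\theta_0)\subseteq S$ (for instance $S=\mathbb R^p$ or $S=B_\rho(\theta_0)$), and all initial points $\theta_1$. Suppose that 1. (loss) for all $t\le T$ and $i\le n_t$, $\ell(y_{t,i},\cdot)$ is nonnegative and twice differentiable on $\mathbb R$, and its first and second derivatives satisfy $|\ell'|\le\lambda$ and $\ell''\ge a$ at every prediction $f(\theta;x_{t,i})$ with $\theta\in B_\rho(\theta_0)$; 2. (unique minimizers) for all $t\le T$, $\mathcal L(\cdot\,;\mathbf z_t)$ has a unique minimizer over $S$; 3. (quadratic growth) for all $t\le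 T$ and every $\theta\in S$ that does not minimize $\mathcal L(\cdot\,;\mathbf z_t)$ over $S$, $\mathcal L(\theta;\mathbf z_t)-\mathcal L(\theta_t^*;\mathbf z_t)\ge\frac\mu2\|\theta-\theta_t^*\|_2^2$, where $\theta_t^*$ is the projection of $\theta$ onto the set of minimizers of $\mathcal L(\cdot\,;\mathbf z_t)$ over $S$; 4. (online gradient descent) $\theta_{t+1}=\theta_t-\eta_t\nabla_\theta\mathcal L(\theta_t;\mathbf z_t)$ for $1\le t\le T$, with step size $\eta_t=\frac4{\mu t}$, and the iterates $\theta_1,\dots,\theta_T$ lie in $B_\rho(\theta_0)$. Then for every $\theta^*\in\arg\min_{\theta\in B_\rho(\theta_0)}\sum_{t=1}^T\mathcal L(\theta;\mathbf z_t)$, $$\sum_{t=1}^T\big(\mathcal L(\theta_t;\mathbf z_t)-\mathcal L(\theta^*;\mathbf z_t)\big)\ \le\ 2\sum_{t=1}^T\mathcal L(\theta^*;\mathbf z_t)+C_1\log T+C_2\,\frac{T}{\sqrt m}.$$ -/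

import Mathlib

open scoped Gradient

namespace NeuralOGD

noncomputable section

/-- Width of layer `l`: the input (layer `0`) has dimension `d`, every hidden layer has width `m`. -/
def width (d m : ℕ) : ℕ → ℕ
  | 0 => d
  | _ + 1 => m

/-- Index set of the entries `W⁽ˡ⁺¹⁾ᵢⱼ` of the weight matrices of the `L` hidden layers. -/
abbrev WeightIdx (L d m : ℕ) : Type :=
  Σ l : Fin L, Fin (width d m (l.val + 1)) × Fin (width d m l.val)

/-- Index set of all parameters: the weight matrices and the output vector `v`. -/
abbrev ParamIdx (L d m : ℕ) : Type :=
  WeightIdx L d m ⊕ Fin (width d m L)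

/-- The parameter space `ℝᵖ` with its Euclidean norm. -/
abbrev Param (L d m : ℕ) : Type :=
  EuclideanSpace ℝ (ParamIdx L d m)

/-- The output of layer `l`: `α⁽⁰⁾ = x` and
`α⁽ˡ⁺¹⁾ = φ (W⁽ˡ⁺¹⁾ α⁽ˡ⁾ / √(width of layer l))`, with `φ` applied entrywise. -/
def layer {L d m : ℕ} (φ : ℝ → ℝ) (θ : Param L d m) (x : EuclideanSpace ℝ (Fin d)) :
    (l : ℕ) → l ≤ L → Fin (width d m l) → ℝ
  | 0, _ => fun j => x j
  | l + 1, h => fun i =>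
      φ ((∑ j : Fin (width d m l),
        θ (Sum.inl ⟨⟨l, h⟩, (i, j)⟩) * layer φ θ x l (Nat.le_of_succ_le h) j) /
          √(width d m l : ℝ))

/-- The network `f(θ; x) = vᵀ α⁽ᴸ⁾(x) / √m` with `L ≥ 1` hidden layers. -/
def net {L d m : ℕ} (φ : ℝ → ℝ) (θ : Param L d m) (x : EuclideanSpace ℝ (Fin d)) : ℝ :=
  (∑ i : Fin (width d m L), θ (Sum.inr i) * layer φ θ x L le_rfl i) / √(width d m L : ℝ)

/-- The data `z = {(xᵢ, yᵢ)}ᵢ` of one round: a nonempty finite batch of inputs and outcomes. -/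
structure Batch (d : ℕ) where
  size : ℕ
  size_pos : 0 < size
  x : Fin size → EuclideanSpace ℝ (Fin d)
  y : Fin size → ℝ

/-- The loss of a round, `𝓛(θ; z) = (1/n) ∑ᵢ ℓ(yᵢ, f(θ; xᵢ))`. -/
def batchLoss {L d m : ℕ} (φ : ℝ → ℝ) (ℓ : ℝ → ℝ → ℝ) (z : Batch d) (θ : Param L d m) : ℝ :=
  (∑ i : Fin z.size, ℓ (z.y i) (net φ θ (z.x i))) / (z.size : ℝ)

/-- Twice differentiable activation with bounded first and second derivative. -/
def SmoothActivation (φ : ℝ → ℝ) : Prop :=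
  Differentiable ℝ φ ∧ Differentiable ℝ (deriv φ) ∧
    ∃ β : ℝ, ∀ u : ℝ, |deriv φ u| ≤ β ∧ |deriv (deriv φ) u| ≤ β

/-- On the batch `z` the loss is nonnegative and twice differentiable in the prediction, and at every
prediction made by a parameter of `B` it satisfies `|ℓ'| ≤ lam` and `ℓ'' ≥ a`. -/
def LossAssumption {L d m : ℕ} (φ : ℝ → ℝ) (ℓ : ℝ → ℝ → ℝ) (lam a : ℝ)
    (B : Set (Param L d m)) (z : Batch d) : Prop :=
  ∀ i : Fin z.size,
    (∀ u : ℝ, 0 ≤ ℓ (z.y i) u) ∧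
    Differentiable ℝ (ℓ (z.y i)) ∧ Differentiable ℝ (deriv (ℓ (z.y i))) ∧
    ∀ θ ∈ B, |deriv (ℓ (z.y i)) (net φ θ (z.x i))| ≤ lam ∧
      a ≤ deriv (deriv (ℓ (z.y i))) (net φ θ (z.x i))

/-- The set of minimizers of `F` over `S`. -/
def argminSet {E : Type*} (F : E → ℝ) (S : Set E) : Set E :=
  {θ | θ ∈ S ∧ IsMinOn F S θ}

/-- Quadratic growth of `F` on `S` with constant `μ`: for every `θ ∈ S` that is not a minimizer and
every projection `θ'` of `θ` onto the set of minimizers, `F θ - F θ' ≥ (μ / 2) ‖θ - θ'‖²`. -/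
def QuadraticGrowth {E : Type*} [NormedAddCommGroup E] (F : E → ℝ) (S : Set E) (μ : ℝ) : Prop :=
  ∀ θ ∈ S \ argminSet F S, ∀ θ' ∈ argminSet F S,
    (∀ θ'' ∈ argminSet F S, ‖θ - θ'‖ ≤ ‖θ - θ''‖) →
      μ / 2 * ‖θ - θ'‖ ^ 2 ≤ F θ - F θ'

/-- `θ 1, θ 2, …` are the iterates of online gradient descent over `T` rounds with losses `F t` and
step sizes `η t`. -/
def IsOGD {E : Type*} [NormedAddCommGroup E] [InnerProductSpace ℝ E] [CompleteSpace E]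
    (F : ℕ → E → ℝ) (η : ℕ → ℝ) (T : ℕ) (θ : ℕ → E) : Prop :=
  ∀ t ∈ Finset.Icc 1 T, θ (t + 1) = θ t - η t • ∇ (F t) (θ t)

/-- Random initialization: the entries of the weight matrices are independent standard Gaussians and
the output vector is a random unit vector (of any law on the unit sphere). -/
def IsRandomInit {L d m : ℕ} {Ω : Type*} [MeasurableSpace Ω] (P : MeasureTheory.Measure Ω)
    (θ₀ : Ω → Param L d m) : Prop :=
  ProbabilityTheory.iIndepFun (fun (k : WeightIdx L d m) (ω : Ω) => θ₀ ω (Sum.inl k)) P ∧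
  (∀ k : WeightIdx L d m, ProbabilityTheory.HasLaw (fun ω => θ₀ ω (Sum.inl k))
    (ProbabilityTheory.gaussianReal 0 1) P) ∧
  (∀ᵐ ω ∂P, ∑ i : Fin (width d m L), θ₀ ω (Sum.inr i) ^ 2 = 1)

/-- The regret bound for the initialization `θ₀`, for every horizon `T ≥ 2`, every loss function, all
data with inputs of norm at most `R`, every parameter domain `S` containing the ball `B_ρ(θ₀)`, and
every run of online gradient descent whose iterates `θ 1, …, θ T` lie in `B_ρ(θ₀)`. -/
def RegretBound {L d m : ℕ} (φ : ℝ → ℝ) (R ρ lam a μ C₁ C₂ : ℝ) (θ₀ : Param L d m) : Prop :=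
  ∀ (ℓ : ℝ → ℝ → ℝ) (T : ℕ) (z : ℕ → Batch d) (S : Set (Param L d m))
    (θ : ℕ → Param L d m) (θstar : Param L d m),
    2 ≤ T →
    (∀ t ∈ Finset.Icc 1 T, ∀ i, ‖(z t).x i‖ ≤ R) →
    (∀ t ∈ Finset.Icc 1 T, LossAssumption φ ℓ lam a (Metric.closedBall θ₀ ρ) (z t)) →
    Metric.closedBall θ₀ ρ ⊆ S →
    (∀ t ∈ Finset.Icc 1 T, QuadraticGrowth (batchLoss φ ℓ (z t)) S μ) →
    (∀ t ∈ Finset.Icc 1 T, ∃! θ', θ' ∈ argminSet (batchLoss φ ℓ (z t)) S) →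
    IsOGD (fun t => batchLoss φ ℓ (z t)) (fun t => 4 / (μ * t)) T θ →
    (∀ t ∈ Finset.Icc 1 T, θ t ∈ Metric.closedBall θ₀ ρ) →
    θstar ∈ argminSet (fun θ' => ∑ t ∈ Finset.Icc 1 T, batchLoss φ ℓ (z t) θ')
      (Metric.closedBall θ₀ ρ) →
    ∑ t ∈ Finset.Icc 1 T, (batchLoss φ ℓ (z t) (θ t) - batchLoss φ ℓ (z t) θstar) ≤
      2 * ∑ t ∈ Finset.Icc 1 T, batchLoss φ ℓ (z t) θstar +
        C₁ * Real.log T + C₂ * (T / √(m : ℝ))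

end

end NeuralOGD

/-! The loss is not convex in the parameters, but on the ball it is convex up to `O(1/√m)`. Call an
initialization tame if its weight matrices have operator norm `O(√m)` and its output vector has norm
`O(1)`. Near it the layers have norm `O(√m)`, yet a parameter change of size `O(1)` moves each of
them by only `O(1)`, with a second-order remainder that is also `O(1)`. The output factor `1/√m`
makes the linearization error of the network `O(1/√m)` (`exists_net_taylor_le`), and convexity of
the loss in the prediction turns this into an approximate tangent inequality
(`LossAssumption.le_batchLoss`).

With steps `4/(μt)` the usual telescoping leaves `(μ/8) ∑ ‖θ_t - θ*‖²`. Quadratic growth at `θ_t`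
and at `θ*`, joined through the unique minimizer of the round, bounds this by half of `∑ (F_t(θ_t) +
F_t(θ*))`. Half of the regret is thus absorbed on the left, at the price of the term `2 ∑ F_t(θ*)`;
the squared gradients contribute `∑ 1/t`, hence `log T` (`ogd_regret_le`).

Randomness enters only through tameness (`IsRandomInit.measure_not_tame_le`). The rest is
deterministic, which makes the bound simultaneous in all data, losses and domains. -/

namespace NeuralOGD

/-! ### Operator norm of a Gaussian matrix by a net argument -/

open MeasureTheory ProbabilityTheory Matrix
open scoped RealInnerProductSpace NNReal

/-- In a finite-dimensional space, the closed ball of radius `2` has a `1`-net with at most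
`5 ^ dim` points. -/
theorem exists_finset_net (E : Type*) [NormedAddCommGroup E] [NormedSpace ℝ E]
    [FiniteDimensional ℝ E] :
    ∃ N : Finset E, N.card ≤ 5 ^ Module.finrank ℝ E ∧ (∀ c ∈ N, ‖c‖ ≤ 2) ∧
      ∀ z : E, ‖z‖ ≤ 2 → ∃ c ∈ N, ‖z - c‖ ≤ 1 := by
  classical
  -- A separated set of largest cardinality is a net, since a point far from all of it could be
  -- added. The packing bound guarantees that a largest one exists.
  let Sep : Finset E → Prop := fun s =>
    (∀ c ∈ s, ‖c‖ ≤ 2) ∧ ∀ c ∈ s, ∀ d ∈ s, c ≠ d → 1 ≤ ‖c - d‖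
  have hcard : ∀ s, Sep s → s.card ≤ 5 ^ Module.finrank ℝ E := fun s hs =>
    Besicovitch.card_le_of_separated s hs.1 hs.2
  let Q : ℕ → Prop := fun n => ∃ s, Sep s ∧ s.card = n
  have hQ0 : Q 0 := ⟨∅, ⟨by simp, by simp⟩, rfl⟩
  obtain ⟨N, hN, hNc⟩ : Q (Nat.findGreatest Q (5 ^ Module.finrank ℝ E)) :=
    Nat.findGreatest_spec (Nat.zero_le _) hQ0
  refine ⟨N, hcard N hN, hN.1, fun z hz => ?_⟩
  by_contra! hfar
  have hzN : z ∉ N := fun h => by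
    have := hfar z h
    simp at this
    linarith
  have hSep : Sep (insert z N) := by
    refine ⟨fun c hc => ?_, fun c hc d hd hcd => ?_⟩
    · rcases Finset.mem_insert.1 hc with rfl | hc
      · exact hz
      · exact hN.1 c hc
    · rcases Finset.mem_insert.1 hc with hc₁ | hc₁ <;>
        rcases Finset.mem_insert.1 hd with hd₁ | hd₁
      · exact absurd (hc₁.trans hd₁.symm) hcd
      · exact hc₁ ▸ (hfar d hd₁).le
      · rw [norm_sub_rev]
        exact hd₁ ▸ (hfar c hc₁).le
      · exact hN.2 c hc₁ d hd₁ hcd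
  have h1 := Nat.le_findGreatest (hcard _ hSep) (show Q _ from ⟨_, hSep, rfl⟩)
  rw [Finset.card_insert_of_notMem hzN] at h1
  omega

theorem norm_le_of_inner_net_le {F : Type*} [NormedAddCommGroup F] [InnerProductSpace ℝ F]
    {N : Finset F} (hN : ∀ z : F, ‖z‖ ≤ 2 → ∃ c ∈ N, ‖z - c‖ ≤ 1) {u : F} {s : ℝ}
    (h : ∀ c ∈ N, ⟪c, u⟫ ≤ s) : ‖u‖ ≤ s := by
  rcases eq_or_ne u 0 with rfl | hu
  · obtain ⟨c, hc, -⟩ := hN 0 (by simp)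
    simpa using h c hc
  have hu' : ‖u‖ ≠ 0 := norm_ne_zero_iff.2 hu
  have hz : ‖(2 / ‖u‖) • u‖ = 2 := by
    rw [norm_smul, norm_div, norm_norm]
    field_simp
    simp
  obtain ⟨c, hc, hzc⟩ := hN _ hz.le
  have h1 : ⟪(2 / ‖u‖) • u, u⟫ = 2 * ‖u‖ := by
    rw [real_inner_smul_left, real_inner_self_eq_norm_sq]
    field_simp
  have h2 : ⟪(2 / ‖u‖) • u - c, u⟫ ≤ ‖u‖ :=
    (real_inner_le_norm _ _).trans (mul_le_of_le_one_left (norm_nonneg _) hzc)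
  rw [inner_sub_left] at h2
  linarith [h c hc]

/-- A unit vector doubled lies within `1` of a net point, so half of the discretization error is at
most `‖A‖ / 2`; this is absorbed into the left side without losing a constant. -/
theorem opNorm_le_of_inner_net_le {E F : Type*} [NormedAddCommGroup E] [NormedSpace ℝ E]
    [NormedAddCommGroup F] [InnerProductSpace ℝ F]
    {N : Finset E} (hN : ∀ z : E, ‖z‖ ≤ 2 → ∃ c ∈ N, ‖z - c‖ ≤ 1)
    {N' : Finset F} (hN' : ∀ z : F, ‖z‖ ≤ 2 → ∃ c ∈ N', ‖z - c‖ ≤ 1)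
    (A : E →L[ℝ] F) {t : ℝ} (ht : 0 ≤ t) (h : ∀ c ∈ N, ∀ c' ∈ N', ⟪c', A c⟫ ≤ t) : ‖A‖ ≤ t := by
  have h1 : ∀ c ∈ N, ‖A c‖ ≤ t := fun c hc => norm_le_of_inner_net_le hN' (h c hc)
  have h2 : ‖A‖ ≤ (t + ‖A‖) / 2 := by
    refine A.opNorm_le_of_unit_norm (by positivity) fun z hz => ?_
    obtain ⟨c, hc, hzc⟩ := hN ((2 : ℝ) • z) (by simp [norm_smul, hz])
    have h3 : ‖A ((2 : ℝ) • z)‖ ≤ ‖A c‖ + ‖A ((2 : ℝ) • z - c)‖ := by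
      rw [map_sub]
      exact norm_le_insert' _ _
    rw [map_smul, norm_smul, Real.norm_two] at h3
    have h4 : ‖A ((2 : ℝ) • z - c)‖ ≤ ‖A‖ := A.le_of_opNorm_le_of_le le_rfl hzc |>.trans (by simp)
    linarith [h1 c hc]
  linarith

/-- The matrix `A` has `ℓ²` operator norm at most `t`. -/
def OpBound {ι κ : Type*} [Fintype ι] [Fintype κ] (A : Matrix ι κ ℝ) (t : ℝ) : Prop :=
  ∀ y : κ → ℝ, ‖WithLp.toLp 2 (A *ᵥ y)‖ ≤ t * ‖WithLp.toLp 2 y‖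

theorem opBound_of_net {ι κ : Type*} [Fintype ι] [Fintype κ]
    {N : Finset (EuclideanSpace ℝ κ)} (hN : ∀ z, ‖z‖ ≤ 2 → ∃ c ∈ N, ‖z - c‖ ≤ 1)
    {N' : Finset (EuclideanSpace ℝ ι)} (hN' : ∀ z, ‖z‖ ≤ 2 → ∃ c ∈ N', ‖z - c‖ ≤ 1)
    (A : Matrix ι κ ℝ) {t : ℝ} (ht : 0 ≤ t)
    (h : ∀ c ∈ N, ∀ c' ∈ N', ∑ p : ι × κ, c' p.1 * c p.2 * A p.1 p.2 ≤ t) : OpBound A t := by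
  classical
  intro y
  have key := opNorm_le_of_inner_net_le hN hN' (Matrix.toEuclideanLin A).toContinuousLinearMap ht
    fun c hc c' hc' => by
      refine le_of_eq_of_le ?_ (h c hc c' hc')
      simp only [LinearMap.coe_toContinuousLinearMap', Fintype.sum_prod_type, PiLp.inner_apply,
        Matrix.toLpLin_apply, mulVec, dotProduct]
      simp only [RCLike.inner_apply, conj_trivial, Finset.sum_mul]
      exact Finset.sum_congr rfl fun i _ => Finset.sum_congr rfl fun j _ => by ring
  exact (Matrix.toEuclideanLin A).toContinuousLinearMap.le_of_opNorm_le key (WithLp.toLp 2 y)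

theorem hasSubgaussianMGF_of_hasLaw_gaussian {Ω : Type*} [MeasurableSpace Ω] {P : Measure Ω}
    {X : Ω → ℝ} (hX : HasLaw X (gaussianReal 0 1) P) : HasSubgaussianMGF X 1 P where
  integrable_exp_mul t := by
    have := integrable_exp_mul_gaussianReal (μ := 0) (v := 1) t
    rw [← hX.map_eq, integrable_map_measure (by fun_prop) hX.aemeasurable] at this
    exact this
  mgf_le t := by
    rw [mgf_gaussianReal hX.map_eq]
    simp

/-- A bilinear form in a standard Gaussian matrix is sub-Gaussian. -/
theorem measure_bilin_ge_le {ι κ Ω : Type*} [Fintype ι] [Fintype κ] [MeasurableSpace Ω]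
    {P : Measure Ω} [IsProbabilityMeasure P] {g : ι × κ → Ω → ℝ} (hind : iIndepFun g P)
    (hg : ∀ p, HasLaw (g p) (gaussianReal 0 1) P)
    {c : EuclideanSpace ℝ κ} {c' : EuclideanSpace ℝ ι} (hc : ‖c‖ ≤ 2) (hc' : ‖c'‖ ≤ 2)
    {t : ℝ} (ht : 0 < t) :
    P {ω | t ≤ ∑ p : ι × κ, c' p.1 * c p.2 * g p ω} ≤ ENNReal.ofReal (Real.exp (-t ^ 2 / 32)) := by
  have hind' : iIndepFun (fun (p : ι × κ) ω => c' p.1 * c p.2 * g p ω) P :=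
    hind.comp (fun p x => c' p.1 * c p.2 * x) fun p => by fun_prop
  have hsub := HasSubgaussianMGF.sum_of_iIndepFun hind' (s := Finset.univ)
    fun p _ => (hasSubgaussianMGF_of_hasLaw_gaussian (hg p)).const_mul (c' p.1 * c p.2)
  set V : ℝ≥0 := ∑ p : ι × κ, (⟨(c' p.1 * c p.2) ^ 2, sq_nonneg _⟩ * 1 : ℝ≥0) with hV
  have hVr : (V : ℝ) = ‖c'‖ ^ 2 * ‖c‖ ^ 2 := by
    simp only [hV, NNReal.coe_sum, EuclideanSpace.norm_sq_eq,
      Fintype.sum_prod_type, Finset.sum_mul, Finset.mul_sum, Real.norm_eq_abs, sq_abs, mul_pow]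
    rw [Finset.sum_comm]
    exact Finset.sum_congr rfl fun j _ => Finset.sum_congr rfl fun i _ => mul_one _
  -- Net points have norm at most `2`; the `32` in the tail is twice this variance proxy.
  have hV16 : (V : ℝ) ≤ 16 := by
    rw [hVr]
    nlinarith [norm_nonneg c, norm_nonneg c', pow_le_pow_left₀ (norm_nonneg c) hc 2,
      pow_le_pow_left₀ (norm_nonneg c') hc' 2, sq_nonneg ‖c‖, sq_nonneg ‖c'‖]
  -- For `V = 0` the Chernoff exponent is a division by zero and yields only the bound `1`; the sum
  -- then vanishes almost surely.
  rcases eq_or_ne V 0 with hV0 | hV0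
  · rw [hV0] at hsub
    have h0 : P {ω | t ≤ ∑ p : ι × κ, c' p.1 * c p.2 * g p ω} = 0 := by
      refine measure_mono_null (fun ω hω => ?_) hsub.ae_eq_zero_of_hasSubgaussianMGF_zero
      intro h
      exact ht.not_ge (le_of_le_of_eq hω h)
    rw [h0]
    exact zero_le
  have hVpos : (0 : ℝ) < V := by positivity
  rw [← ofReal_measureReal (measure_ne_top _ _)]
  refine ENNReal.ofReal_le_ofReal ((hsub.measure_ge_le ht.le).trans (Real.exp_le_exp.2 ?_))
  rw [neg_div, neg_div, neg_le_neg_iff]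
  exact div_le_div_of_nonneg_left (sq_nonneg t) (by positivity) (by linarith)

/-- Tail bound for the operator norm of a standard Gaussian matrix. -/
theorem measure_not_opBound_le {ι κ Ω : Type*} [Fintype ι] [Fintype κ] [MeasurableSpace Ω]
    {P : Measure Ω} [IsProbabilityMeasure P] {g : ι × κ → Ω → ℝ} (hind : iIndepFun g P)
    (hg : ∀ p, HasLaw (g p) (gaussianReal 0 1) P) {t : ℝ} (ht : 0 < t) :
    P {ω | ¬ OpBound (Matrix.of fun i j => g (i, j) ω) t} ≤
      ENNReal.ofReal (5 ^ (Fintype.card ι + Fintype.card κ) * Real.exp (-t ^ 2 / 32)) := by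
  obtain ⟨N, hNc, hN2, hN⟩ := exists_finset_net (EuclideanSpace ℝ κ)
  obtain ⟨N', hNc', hN2', hN'⟩ := exists_finset_net (EuclideanSpace ℝ ι)
  rw [finrank_euclideanSpace] at hNc hNc'
  have hsub : {ω | ¬ OpBound (Matrix.of fun i j => g (i, j) ω) t} ⊆
      ⋃ q ∈ N ×ˢ N', {ω | t ≤ ∑ p : ι × κ, q.2 p.1 * q.1 p.2 * g p ω} := by
    intro ω hω
    by_contra hcon
    refine hω (opBound_of_net hN hN' _ ht.le fun c hc c' hc' => ?_)
    simp only [Set.mem_iUnion, not_exists, Set.mem_ofPred_eq, not_le] at hcon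
    exact (hcon (c, c') (Finset.mk_mem_product hc hc')).le
  refine (measure_mono hsub).trans ((measure_biUnion_finset_le _ _).trans ?_)
  refine (Finset.sum_le_card_nsmul _ _ _ fun q hq => ?_).trans (?_ : (N ×ˢ N').card •
    ENNReal.ofReal (Real.exp (-t ^ 2 / 32)) ≤ _)
  · rw [Finset.mem_product] at hq
    exact measure_bilin_ge_le hind hg (hN2 _ hq.1) (hN2' _ hq.2) ht
  · rw [nsmul_eq_mul, ENNReal.ofReal_mul (by positivity)]
    gcongr
    rw [Finset.card_product, ← ENNReal.ofReal_natCast]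
    refine ENNReal.ofReal_le_ofReal ?_
    rw [pow_add, mul_comm (5 ^ _)]
    push_cast
    exact_mod_cast Nat.mul_le_mul hNc hNc'

end NeuralOGD

namespace NeuralOGD

open Matrix

/-! ### Euclidean and operator norms of plain vectors and matrices -/

section Euclidean

variable {ι κ : Type*} [Fintype ι] [Fintype κ]

/-- The Euclidean norm of a plain finite family of reals. -/
noncomputable def l2 {ι : Type*} [Fintype ι] (x : ι → ℝ) : ℝ := ‖WithLp.toLp 2 x‖

theorem l2_nonneg (x : ι → ℝ) : 0 ≤ l2 x := norm_nonneg _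

theorem l2_sq (x : ι → ℝ) : l2 x ^ 2 = ∑ i, x i ^ 2 := by
  simp [l2, EuclideanSpace.norm_sq_eq]

theorem l2_add_le (x y : ι → ℝ) : l2 (x + y) ≤ l2 x + l2 y := by
  simpa [l2] using norm_add_le (WithLp.toLp 2 x) (WithLp.toLp 2 y)

theorem l2_smul (c : ℝ) (x : ι → ℝ) : l2 (c • x) = |c| * l2 x := by
  simp [l2, norm_smul]

@[simp] theorem l2_zero : l2 (0 : ι → ℝ) = 0 := by simp [l2]

theorem l2_mono {x y : ι → ℝ} (h : ∀ i, |x i| ≤ |y i|) : l2 x ≤ l2 y := by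
  refine le_of_sq_le_sq ?_ (l2_nonneg y)
  rw [l2_sq, l2_sq]
  exact Finset.sum_le_sum fun i _ => sq_le_sq.2 (h i)

theorem l2_le_mul {x y : ι → ℝ} {β : ℝ} (hβ : 0 ≤ β) (h : ∀ i, |x i| ≤ β * |y i|) :
    l2 x ≤ β * l2 y := by
  have : l2 x ≤ l2 (β • y) := l2_mono fun i => by
    simpa [abs_mul, abs_of_nonneg hβ] using h i
  rwa [l2_smul, abs_of_nonneg hβ] at this

theorem l2_const (c : ℝ) : l2 (fun _ : ι => c) = √(Fintype.card ι) * |c| := by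
  rw [l2, EuclideanSpace.norm_eq]
  simp [Real.sqrt_mul, Real.sqrt_sq_eq_abs]

theorem l2_pow_two_le (x : ι → ℝ) : l2 (fun i => x i ^ 2) ≤ l2 x ^ 2 := by
  refine le_of_sq_le_sq ?_ (sq_nonneg _)
  rw [l2_sq, l2_sq]
  exact Finset.sum_sq_le_sq_sum_of_nonneg fun i _ => sq_nonneg _

theorem abs_dotProduct_le (x y : ι → ℝ) : |x ⬝ᵥ y| ≤ l2 x * l2 y := by
  have := abs_real_inner_le_norm (WithLp.toLp 2 y) (WithLp.toLp 2 x)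
  rw [EuclideanSpace.inner_toLp_toLp] at this
  simpa [l2, mul_comm] using this

theorem OpBound.l2_mulVec_le {A : Matrix ι κ ℝ} {t : ℝ} (h : OpBound A t) (y : κ → ℝ) :
    l2 (A *ᵥ y) ≤ t * l2 y := h y

theorem OpBound.mono {A : Matrix ι κ ℝ} {t t' : ℝ} (h : OpBound A t) (htt' : t ≤ t') :
    OpBound A t' := fun y => (h y).trans (by gcongr)

theorem OpBound.add {A B : Matrix ι κ ℝ} {s t : ℝ} (hA : OpBound A s) (hB : OpBound B t) :
    OpBound (A + B) (s + t) := fun y => by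
  change l2 _ ≤ (s + t) * l2 y
  rw [add_mulVec, add_mul]
  exact (l2_add_le _ _).trans (add_le_add (hA y) (hB y))

/-- The operator norm is at most the Frobenius norm. -/
theorem opBound_of_sum_sq_le {A : Matrix ι κ ℝ} {t : ℝ} (ht : 0 ≤ t)
    (h : ∑ i, ∑ j, A i j ^ 2 ≤ t ^ 2) : OpBound A t := fun y => by
  change l2 _ ≤ t * l2 y
  refine le_of_sq_le_sq ?_ (mul_nonneg ht (l2_nonneg y))
  rw [l2_sq, mul_pow]
  calc ∑ i, (A *ᵥ y) i ^ 2 ≤ ∑ i, (∑ j, A i j ^ 2) * l2 y ^ 2 :=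
        Finset.sum_le_sum fun i _ => by
          rw [l2_sq]
          exact Finset.sum_mul_sq_le_sq_mul_sq _ _ _
    _ = (∑ i, ∑ j, A i j ^ 2) * l2 y ^ 2 := by rw [Finset.sum_mul]
    _ ≤ t ^ 2 * l2 y ^ 2 := by gcongr

end Euclidean

/-! ### First- and second-order estimates for one layer -/

section Activation

variable {φ : ℝ → ℝ} {β : ℝ}

theorem abs_sub_le_of_abs_deriv_le (hφ : Differentiable ℝ φ) (hβ : ∀ u, |deriv φ u| ≤ β)
    (u v : ℝ) : |φ v - φ u| ≤ β * |v - u| :=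
  Convex.norm_image_sub_le_of_norm_deriv_le (fun x _ => hφ x) (fun x _ => hβ x) convex_univ
    (Set.mem_univ u) (Set.mem_univ v)

/-- Mean value inequality for `x ↦ φ x - φ'(u) x`, whose derivative is at most `β |v - u|` between
`u` and `v`. No continuity of `φ''` is needed; the factor `1/2` is given up. -/
theorem abs_taylor_le (hφ : Differentiable ℝ φ) (hφ' : Differentiable ℝ (deriv φ))
    (hβ : ∀ u, |deriv (deriv φ) u| ≤ β) (u v : ℝ) :
    |φ v - φ u - deriv φ u * (v - u)| ≤ β * (v - u) ^ 2 := by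
  have hd : ∀ x, HasDerivAt (fun x => φ x - deriv φ u * x) (deriv φ x - deriv φ u) x := fun x => by
    simpa using! (hφ x).hasDerivAt.sub ((hasDerivAt_id x).const_mul (deriv φ u))
  have hβ0 : 0 ≤ β := (abs_nonneg _).trans (hβ 0)
  have := Convex.norm_image_sub_le_of_norm_hasDerivWithin_le (C := β * |v - u|)
    (s := Set.uIcc u v) (fun x _ => (hd x).hasDerivWithinAt) (fun x hx => by
      refine (abs_sub_le_of_abs_deriv_le hφ' hβ u x).trans ?_
      exact mul_le_mul_of_nonneg_left (Set.abs_sub_left_of_mem_uIcc hx) hβ0) (convex_uIcc u v) Set.left_mem_uIcc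
      Set.right_mem_uIcc
  simp only [Real.norm_eq_abs] at this
  rw [mul_assoc, abs_mul_abs_self, ← pow_two] at this
  convert this using 2
  ring

variable {ι κ : Type*} [Fintype ι] [Fintype κ]

theorem l2_activation_le (hφ : Differentiable ℝ φ) (hβ : ∀ u, |deriv φ u| ≤ β) (u : ι → ℝ) :
    l2 (fun i => φ (u i)) ≤ √(Fintype.card ι) * |φ 0| + β * l2 u := by
  have hβ0 : 0 ≤ β := (abs_nonneg _).trans (hβ 0)
  have h : (fun i => φ (u i)) = (fun _ => φ 0) + fun i => φ (u i) - φ 0 := by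
    ext i
    simp
  rw [h, ← l2_const (ι := ι)]
  refine (l2_add_le _ _).trans (add_le_add le_rfl (l2_le_mul hβ0 fun i => ?_))
  simpa using abs_sub_le_of_abs_deriv_le hφ hβ 0 (u i)

theorem l2_activation_sub_le (hφ : Differentiable ℝ φ) (hβ : ∀ u, |deriv φ u| ≤ β)
    (u v : ι → ℝ) : l2 (fun i => φ (v i) - φ (u i)) ≤ β * l2 (v - u) :=
  l2_le_mul ((abs_nonneg _).trans (hβ 0)) fun i => abs_sub_le_of_abs_deriv_le hφ hβ (u i) (v i)

/-- Here `w` is the linearized change of the preactivation: its error passes through `φ'`, and the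
scalar Taylor remainder is added. Since the `ℓ²` norm of the entrywise squares is at most the
squared `ℓ²` norm, no factor of the dimension appears. -/
theorem l2_activation_taylor_le (hφ : Differentiable ℝ φ) (hφ' : Differentiable ℝ (deriv φ))
    (hβ : ∀ u, |deriv φ u| ≤ β ∧ |deriv (deriv φ) u| ≤ β) (u v w : ι → ℝ) :
    l2 (fun i => φ (v i) - φ (u i) - deriv φ (u i) * w i) ≤
      β * l2 (v - u - w) + β * l2 (v - u) ^ 2 := by
  have hβ0 : 0 ≤ β := (abs_nonneg _).trans (hβ 0).1
  have h : (fun i => φ (v i) - φ (u i) - deriv φ (u i) * w i) =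
      (fun i => deriv φ (u i) * (v - u - w) i) +
        fun i => φ (v i) - φ (u i) - deriv φ (u i) * (v i - u i) := by
    ext i
    simp only [Pi.add_apply, Pi.sub_apply]
    ring
  rw [h]
  refine (l2_add_le _ _).trans (add_le_add (l2_le_mul hβ0 fun i => ?_) ?_)
  · rw [abs_mul]
    exact mul_le_mul_of_nonneg_right (hβ _).1 (abs_nonneg _)
  · refine (l2_le_mul (y := fun i => (v - u) i ^ 2) hβ0 fun i => ?_).trans
      (mul_le_mul_of_nonneg_left (l2_pow_two_le _) hβ0)
    rw [abs_of_nonneg (sq_nonneg ((v - u) i))]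
    exact abs_taylor_le hφ hφ' (fun u => (hβ u).2) (u i) (v i)

theorem l2_mulVec_sub_le {W W' : Matrix ι κ ℝ} {ω τ : ℝ} (hW : OpBound W ω)
    (hW' : OpBound (W' - W) τ) (a a' : κ → ℝ) :
    l2 (W' *ᵥ a' - W *ᵥ a) ≤ ω * l2 (a' - a) + τ * l2 a' := by
  have h : W' *ᵥ a' - W *ᵥ a = W *ᵥ (a' - a) + (W' - W) *ᵥ a' := by
    rw [mulVec_sub, sub_mulVec]
    abel
  rw [h]
  exact (l2_add_le _ _).trans (add_le_add (hW _) (hW' _))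

theorem l2_mulVec_taylor_le {W W' : Matrix ι κ ℝ} {ω τ : ℝ} (hW : OpBound W ω)
    (hW' : OpBound (W' - W) τ) (a a' b : κ → ℝ) :
    l2 (W' *ᵥ a' - W *ᵥ a - (W *ᵥ b + (W' - W) *ᵥ a)) ≤
      ω * l2 (a' - a - b) + τ * l2 (a' - a) := by
  have h : W' *ᵥ a' - W *ᵥ a - (W *ᵥ b + (W' - W) *ᵥ a) =
      W *ᵥ (a' - a - b) + (W' - W) *ᵥ (a' - a) := by
    simp only [mulVec_sub, sub_mulVec]
    abel
  rw [h]
  exact (l2_add_le _ _).trans (add_le_add (hW _) (hW' _))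

end Activation

/-! ### The network, tame parameters and directional derivatives -/

section Network

variable {L d m : ℕ}

/-- The weight matrix of layer `l + 1`. -/
def weight (θ : Param L d m) (l : ℕ) (h : l < L) :
    Matrix (Fin (width d m (l + 1))) (Fin (width d m l)) ℝ :=
  Matrix.of fun i j => θ (Sum.inl ⟨⟨l, h⟩, (i, j)⟩)

/-- The output vector. -/
def outVec (θ : Param L d m) : Fin (width d m L) → ℝ := fun i => θ (Sum.inr i)

theorem weight_sub (θ θ' : Param L d m) (l : ℕ) (h : l < L) :
    weight (θ' - θ) l h = weight θ' l h - weight θ l h := rfl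

theorem outVec_sub (θ θ' : Param L d m) : outVec (θ' - θ) = outVec θ' - outVec θ := rfl

theorem opBound_weight (δ : Param L d m) (l : ℕ) (h : l < L) : OpBound (weight δ l h) ‖δ‖ := by
  refine opBound_of_sum_sq_le (norm_nonneg _) ?_
  rw [EuclideanSpace.norm_sq_eq, Fintype.sum_sum_type, Fintype.sum_sigma]
  simp only [Real.norm_eq_abs, sq_abs]
  refine le_trans ?_ (le_add_of_nonneg_right
    (Finset.sum_nonneg fun (i : Fin (width d m L)) _ => sq_nonneg (δ (Sum.inr i))))
  refine le_trans (le_of_eq ?_) (Finset.single_le_sum (f := fun l : Fin L =>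
    ∑ p : Fin (width d m (l.val + 1)) × Fin (width d m l.val), δ (Sum.inl ⟨l, p⟩) ^ 2)
    (fun _ _ => Finset.sum_nonneg fun _ _ => sq_nonneg _) (Finset.mem_univ (⟨l, h⟩ : Fin L)))
  exact (Fintype.sum_prod_type fun p => δ (Sum.inl ⟨⟨l, h⟩, p⟩) ^ 2).symm

theorem l2_outVec_le (δ : Param L d m) : l2 (outVec δ) ≤ ‖δ‖ := by
  refine le_of_sq_le_sq ?_ (norm_nonneg _)
  rw [EuclideanSpace.norm_sq_eq, Fintype.sum_sum_type, l2_sq]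
  simp only [Real.norm_eq_abs, sq_abs]
  exact le_add_of_nonneg_left (Finset.sum_nonneg fun _ _ => sq_nonneg _)

/-- The weight matrices have operator norm at most `M √m` and the output vector has norm at
most `M`. -/
def Tame (M : ℝ) (θ : Param L d m) : Prop :=
  (∀ l h, OpBound (weight θ l h) (M * √(m : ℝ))) ∧ l2 (outVec θ) ≤ M

theorem Tame.of_norm_sub_le {M r : ℝ} {θ₀ θ : Param L d m} (hm : 1 ≤ m) (h₀ : Tame M θ₀)
    (h : ‖θ - θ₀‖ ≤ r) : Tame (M + r) θ := by
  have hr : 0 ≤ r := (norm_nonneg _).trans h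
  have hm' : 1 ≤ √(m : ℝ) := Real.one_le_sqrt.2 (by exact_mod_cast hm)
  refine ⟨fun l hl => ?_, ?_⟩
  · have h1 := (h₀.1 l hl).add (opBound_weight (θ - θ₀) l hl)
    rw [weight_sub, add_sub_cancel] at h1
    exact h1.mono (by nlinarith)
  · have h1 := l2_add_le (outVec θ₀) (outVec (θ - θ₀))
    rw [outVec_sub, add_sub_cancel, ← outVec_sub] at h1
    linarith [h₀.2, l2_outVec_le (θ - θ₀)]

/-- The preactivation of layer `l + 1`. -/
noncomputable def preact (φ : ℝ → ℝ) (θ : Param L d m) (x : EuclideanSpace ℝ (Fin d)) (l : ℕ) (h : l < L) :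
    Fin (width d m (l + 1)) → ℝ :=
  (√(width d m l : ℝ))⁻¹ • (weight θ l h *ᵥ layer φ θ x l h.le)

theorem layer_succ (φ : ℝ → ℝ) (θ : Param L d m) (x : EuclideanSpace ℝ (Fin d)) (l : ℕ)
    (h : l < L) : layer φ θ x (l + 1) h = fun i => φ (preact φ θ x l h i) := by
  ext i
  simp only [layer, preact, Pi.smul_apply, smul_eq_mul, inv_mul_eq_div]
  rfl

/-- The derivative of layer `l` at `θ` in the direction `δ`. -/
noncomputable def dlayer (φ : ℝ → ℝ) (θ δ : Param L d m) (x : EuclideanSpace ℝ (Fin d)) :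
    (l : ℕ) → l ≤ L → Fin (width d m l) → ℝ
  | 0, _ => 0
  | l + 1, h => fun i => deriv φ (preact φ θ x l h i) *
      ((√(width d m l : ℝ))⁻¹ • (weight θ l h *ᵥ dlayer φ θ δ x l (Nat.le_of_succ_le h) +
        weight δ l h *ᵥ layer φ θ x l (Nat.le_of_succ_le h))) i

/-- The derivative of the network at `θ` in the direction `δ`. -/
noncomputable def dnet (φ : ℝ → ℝ) (θ δ : Param L d m) (x : EuclideanSpace ℝ (Fin d)) : ℝ :=
  (outVec θ ⬝ᵥ dlayer φ θ δ x L le_rfl + outVec δ ⬝ᵥ layer φ θ x L le_rfl) /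
    √(width d m L : ℝ)

theorem net_eq (φ : ℝ → ℝ) (θ : Param L d m) (x : EuclideanSpace ℝ (Fin d)) :
    net φ θ x = (outVec θ ⬝ᵥ layer φ θ x L le_rfl) / √(width d m L : ℝ) := rfl

variable {φ : ℝ → ℝ}

theorem differentiable_layer (hφ : Differentiable ℝ φ) (x : EuclideanSpace ℝ (Fin d)) (l : ℕ)
    (h : l ≤ L) (i : Fin (width d m l)) :
    Differentiable ℝ fun θ : Param L d m => layer φ θ x l h i := by
  induction l with
  | zero => exact differentiable_const _
  | succ l ih =>
    have ih' := ih (Nat.le_of_succ_le h)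
    simp only [layer]
    fun_prop

theorem differentiable_net (hφ : Differentiable ℝ φ) (x : EuclideanSpace ℝ (Fin d)) :
    Differentiable ℝ fun θ : Param L d m => net φ θ x := by
  unfold net
  have h := differentiable_layer (L := L) (m := m) hφ x L le_rfl
  fun_prop

theorem hasDerivAt_coord (θ δ : Param L d m) (k : ParamIdx L d m) :
    HasDerivAt (fun s : ℝ => (θ + s • δ) k) (δ k) 0 := by
  simpa using ((hasDerivAt_id (0 : ℝ)).mul_const (δ k)).const_add (θ k)

theorem hasDerivAt_layer (hφ : Differentiable ℝ φ) (θ δ : Param L d m)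
    (x : EuclideanSpace ℝ (Fin d)) (l : ℕ) (h : l ≤ L) (i : Fin (width d m l)) :
    HasDerivAt (fun s : ℝ => layer φ (θ + s • δ) x l h i) (dlayer φ θ δ x l h i) 0 := by
  induction l with
  | zero => exact hasDerivAt_const _ _
  | succ l ih =>
    have ih' := ih (Nat.le_of_succ_le h)
    have hu : HasDerivAt (fun s : ℝ => preact φ (θ + s • δ) x l h i)
        (((√(width d m l : ℝ))⁻¹ • (weight θ l h *ᵥ dlayer φ θ δ x l (Nat.le_of_succ_le h) +
        weight δ l h *ᵥ layer φ θ x l (Nat.le_of_succ_le h))) i) 0 := by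
      have h1 := (HasDerivAt.fun_sum (u := Finset.univ) fun j _ =>
        (hasDerivAt_coord θ δ (Sum.inl ⟨⟨l, h⟩, (i, j)⟩)).mul (ih' j)).const_mul
          (√(width d m l : ℝ))⁻¹
      simp only [zero_smul, add_zero] at h1
      convert! h1 using 1
      simp only [Pi.smul_apply, Pi.add_apply, mulVec, dotProduct, smul_eq_mul,
        ← Finset.sum_add_distrib, weight, Matrix.of_apply]
      congr 1
      exact Finset.sum_congr rfl fun j _ => add_comm _ _
    have h2 := HasDerivAt.comp (0 : ℝ) (hφ (preact φ (θ + (0 : ℝ) • δ) x l h i)).hasDerivAt hu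
    simp only [zero_smul, add_zero] at h2
    simp only [layer_succ]
    exact h2

theorem fderiv_net (hφ : Differentiable ℝ φ) (θ δ : Param L d m)
    (x : EuclideanSpace ℝ (Fin d)) :
    fderiv ℝ (fun θ : Param L d m => net φ θ x) θ δ = dnet φ θ δ x := by
  have h1 := (HasDerivAt.fun_sum (u := Finset.univ) fun j _ =>
    (hasDerivAt_coord θ δ (Sum.inr j)).mul (hasDerivAt_layer hφ θ δ x L le_rfl j)).div_const
      (√(width d m L : ℝ))
  simp only [zero_smul, add_zero] at h1
  have h2 := ((differentiable_net hφ x θ).hasFDerivAt.hasLineDerivAt δ).unique h1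
  rw [h2, dnet]
  simp only [dotProduct, outVec, ← Finset.sum_add_distrib]
  congr 1
  exact Finset.sum_congr rfl fun j _ => add_comm _ _

end Network

end NeuralOGD

namespace NeuralOGD

open Matrix

/-! ### Bounds uniform in the width -/

section Bounds

variable {φ : ℝ → ℝ} {β : ℝ} {L d : ℕ}

theorem inv_sqrt_mul_le (w : ℕ) {X : ℝ} (hX : 0 ≤ X) : (√(w : ℝ))⁻¹ * (X * √(w : ℝ)) ≤ X := by
  rw [mul_left_comm]
  exact mul_le_of_le_one_right hX inv_mul_le_one

/-- In hidden layers `1/√m` cancels the `√m` of the weights. In the first layer the factor is only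
`1/√d`, but there `X` measures a change of the fixed input, which is zero. -/
theorem inv_sqrt_width_mul_le {m : ℕ} {M X : ℝ} (hM : 0 ≤ M) (hX : 0 ≤ X) (l : ℕ)
    (h0 : l = 0 → X = 0) : (√(width d m l : ℝ))⁻¹ * (M * √(m : ℝ) * X) ≤ M * X := by
  cases l with
  | zero => simp [h0 rfl]
  | succ l =>
    have := inv_sqrt_mul_le m (mul_nonneg hM hX)
    rw [mul_right_comm] at this
    exact this

theorem l2_preact_sub {m : ℕ} (θ θ' : Param L d m) (x : EuclideanSpace ℝ (Fin d)) (l : ℕ) (h : l < L) :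
    l2 (preact φ θ' x l h - preact φ θ x l h) = (√(width d m l : ℝ))⁻¹ *
      l2 (weight θ' l h *ᵥ layer φ θ' x l h.le - weight θ l h *ᵥ layer φ θ x l h.le) := by
  rw [preact, preact, ← smul_sub, l2_smul, abs_of_nonneg (by positivity)]

theorem exists_l2_layer_le {R M : ℝ} (hφ : Differentiable ℝ φ)
    (hβ : ∀ u, |deriv φ u| ≤ β) (hR : 0 ≤ R) (hM : 0 ≤ M) (L d l : ℕ) :
    ∃ A, 0 ≤ A ∧ ∀ (m : ℕ) (θ : Param L d m) (x : EuclideanSpace ℝ (Fin d)) (h : l ≤ L),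
      Tame M θ → ‖x‖ ≤ R → l2 (layer φ θ x l h) ≤ A * √(width d m l : ℝ) := by
  have hβ0 : 0 ≤ β := (abs_nonneg _).trans (hβ 0)
  induction l with
  | zero =>
    refine ⟨R, hR, fun m θ x h _ hx => ?_⟩
    change ‖x‖ ≤ R * √(d : ℝ)
    rcases Nat.eq_zero_or_pos d with rfl | hd
    · simp [Subsingleton.elim x 0]
    · exact hx.trans (le_mul_of_one_le_right hR (Real.one_le_sqrt.2 (by exact_mod_cast hd)))
  | succ l ih =>
    obtain ⟨A, hA, ih⟩ := ih
    refine ⟨|φ 0| + β * (M * A), by positivity, fun m θ x h hθ hx => ?_⟩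
    rw [layer_succ]
    refine (l2_activation_le hφ hβ _).trans ?_
    have h1 : l2 (preact φ θ x l h) ≤ M * A * √(m : ℝ) := by
      rw [preact, l2_smul, abs_of_nonneg (by positivity)]
      calc _ ≤ (√(width d m l : ℝ))⁻¹ * (M * √(m : ℝ) * (A * √(width d m l : ℝ))) := by
            gcongr
            exact ((hθ.1 l h).l2_mulVec_le _).trans (by gcongr; exact ih m θ x _ hθ hx)
        _ ≤ M * √(m : ℝ) * A := by
            rw [← mul_assoc (M * √(m : ℝ))]
            exact inv_sqrt_mul_le _ (by positivity)
        _ = _ := by ring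
    rw [Fintype.card_fin]
    change √(m : ℝ) * |φ 0| + _ ≤ _ * √(m : ℝ)
    nlinarith [mul_le_mul_of_nonneg_left h1 hβ0]

/-- Two effects add up: the old weights act on the change of the previous layer, and the change of
the weights, of operator norm at most `‖θ' - θ‖`, acts on a layer of norm `A √width`. The scaling
removes the square root in both, so the constant does not depend on `m`. -/
theorem exists_l2_layer_sub_le {R M : ℝ} (hφ : Differentiable ℝ φ)
    (hβ : ∀ u, |deriv φ u| ≤ β) (hR : 0 ≤ R) (hM : 0 ≤ M) (L d l : ℕ) :
    ∃ B, 0 ≤ B ∧ ∀ (m : ℕ) (θ θ' : Param L d m) (x : EuclideanSpace ℝ (Fin d)),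
      Tame M θ → Tame M θ' → ‖x‖ ≤ R →
      (∀ h : l < L, l2 (preact φ θ' x l h - preact φ θ x l h) ≤ B * ‖θ' - θ‖) ∧
      ∀ h : l ≤ L, l2 (layer φ θ' x l h - layer φ θ x l h) ≤ B * ‖θ' - θ‖ := by
  have hβ0 : 0 ≤ β := (abs_nonneg _).trans (hβ 0)
  have key : ∀ l B, 0 ≤ B → (∀ (m : ℕ) (θ θ' : Param L d m) (x : EuclideanSpace ℝ (Fin d))
      (h : l ≤ L), Tame M θ → Tame M θ' → ‖x‖ ≤ R →
        l2 (layer φ θ' x l h - layer φ θ x l h) ≤ B * ‖θ' - θ‖) →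
      ∃ B', 0 ≤ B' ∧ ∀ (m : ℕ) (θ θ' : Param L d m) (x : EuclideanSpace ℝ (Fin d))
      (h : l < L), Tame M θ → Tame M θ' → ‖x‖ ≤ R →
        l2 (preact φ θ' x l h - preact φ θ x l h) ≤ B' * ‖θ' - θ‖ := by
    intro l B hB hl
    obtain ⟨A, hA, hlayer⟩ := exists_l2_layer_le hφ hβ hR hM L d l
    refine ⟨M * B + A, by positivity, fun m θ θ' x h hθ hθ' hx => ?_⟩
    rw [l2_preact_sub]
    set X := l2 (layer φ θ' x l h.le - layer φ θ x l h.le)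
    calc _ ≤ (√(width d m l : ℝ))⁻¹ * (M * √(m : ℝ) * X +
          ‖θ' - θ‖ * (A * √(width d m l : ℝ))) := by
          gcongr
          refine (l2_mulVec_sub_le (hθ.1 l h) (opBound_weight (θ' - θ) l h) _ _).trans ?_
          gcongr
          exact hlayer m θ' x _ hθ' hx
      _ ≤ M * X + ‖θ' - θ‖ * A := by
          rw [mul_add, ← mul_assoc ‖θ' - θ‖]
          refine add_le_add (inv_sqrt_width_mul_le hM (l2_nonneg _) l ?_)
            (inv_sqrt_mul_le _ (by positivity))
          rintro rfl
          simp [layer]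
      _ ≤ M * (B * ‖θ' - θ‖) + ‖θ' - θ‖ * A := by
          gcongr
          exact hl m θ θ' x h.le hθ hθ' hx
      _ = _ := by ring
  have main : ∃ B, 0 ≤ B ∧ ∀ (m : ℕ) (θ θ' : Param L d m) (x : EuclideanSpace ℝ (Fin d))
      (h : l ≤ L), Tame M θ → Tame M θ' → ‖x‖ ≤ R →
        l2 (layer φ θ' x l h - layer φ θ x l h) ≤ B * ‖θ' - θ‖ := by
    induction l with
    | zero => exact ⟨0, le_rfl, fun m θ θ' x h _ _ _ => by simp [layer]⟩
    | succ l ih =>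
      obtain ⟨B, hB, ih⟩ := ih
      obtain ⟨B', hB', hpre⟩ := key l B hB ih
      refine ⟨β * B', by positivity, fun m θ θ' x h hθ hθ' hx => ?_⟩
      simp only [layer_succ _ _ _ l h]
      refine (l2_activation_sub_le hφ hβ _ _).trans ?_
      rw [mul_assoc]
      exact mul_le_mul_of_nonneg_left (hpre m θ θ' x h hθ hθ' hx) hβ0
  obtain ⟨B, hB, hlay⟩ := main
  obtain ⟨B', hB', hpre⟩ := key l B hB hlay
  refine ⟨B + B', by positivity, fun m θ θ' x hθ hθ' hx => ⟨fun h => ?_, fun h => ?_⟩⟩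
  · exact (hpre m θ θ' x h hθ hθ' hx).trans (by gcongr; linarith)
  · exact (hlay m θ θ' x h hθ hθ' hx).trans (by gcongr; linarith)

/-- The new errors are the weight change acting on the layer change and the curvature of `φ`. Both
are quadratic in `‖θ' - θ‖` because layer and preactivation changes are linear in it, with constants
free of `m`. -/
theorem exists_l2_layer_taylor_le {R M : ℝ} (hφ : Differentiable ℝ φ)
    (hφ' : Differentiable ℝ (deriv φ)) (hβ : ∀ u, |deriv φ u| ≤ β ∧ |deriv (deriv φ) u| ≤ β)
    (hR : 0 ≤ R) (hM : 0 ≤ M) (L d l : ℕ) :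
    ∃ E, 0 ≤ E ∧ ∀ (m : ℕ) (θ θ' : Param L d m) (x : EuclideanSpace ℝ (Fin d)) (h : l ≤ L),
      Tame M θ → Tame M θ' → ‖x‖ ≤ R →
      l2 (layer φ θ' x l h - layer φ θ x l h - dlayer φ θ (θ' - θ) x l h) ≤
        E * ‖θ' - θ‖ ^ 2 := by
  have hβ0 : 0 ≤ β := (abs_nonneg _).trans (hβ 0).1
  induction l with
  | zero => exact ⟨0, le_rfl, fun m θ θ' x h _ _ _ => by simp [layer, dlayer]⟩
  | succ l ih =>
    obtain ⟨E, hE, ih⟩ := ih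
    obtain ⟨B, hB, hdiff⟩ := exists_l2_layer_sub_le hφ (fun u => (hβ u).1) hR hM L d l
    refine ⟨β * (M * E + B) + β * B ^ 2, by positivity, fun m θ θ' x h hθ hθ' hx => ?_⟩
    obtain ⟨hpre, hlay⟩ := hdiff m θ θ' x hθ hθ' hx
    have hl := Nat.le_of_succ_le h
    have hpre := hpre h
    have hlay := hlay hl
    simp only [layer_succ _ _ _ l h, dlayer]
    refine (l2_activation_taylor_le hφ hφ' hβ _ _ _).trans ?_
    rw [add_mul, mul_assoc β, mul_assoc β, ← mul_pow]
    refine add_le_add (mul_le_mul_of_nonneg_left ?_ hβ0)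
      (mul_le_mul_of_nonneg_left (pow_le_pow_left₀ (l2_nonneg _) hpre 2) hβ0)
    rw [preact, preact, ← smul_sub, ← smul_sub, l2_smul, abs_of_nonneg (by positivity)]
    set X := l2 (layer φ θ' x l hl - layer φ θ x l hl -
      dlayer φ θ (θ' - θ) x l hl)
    -- Holds for width zero too, where the inverse is `0` by convention.
    have hw : (√(width d m l : ℝ))⁻¹ ≤ 1 := by
      rcases Nat.eq_zero_or_pos (width d m l) with h0 | h0
      · simp [h0]
      · exact inv_le_one_of_one_le₀ (Real.one_le_sqrt.2 (by exact_mod_cast h0))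
    calc _ ≤ (√(width d m l : ℝ))⁻¹ * (M * √(m : ℝ) * X +
          ‖θ' - θ‖ * (B * ‖θ' - θ‖)) := by
          gcongr
          refine (l2_mulVec_taylor_le (hθ.1 l h) (opBound_weight (θ' - θ) l h) _ _ _).trans ?_
          gcongr
      _ ≤ M * X + ‖θ' - θ‖ * (B * ‖θ' - θ‖) := by
          rw [mul_add]
          refine add_le_add (inv_sqrt_width_mul_le hM (l2_nonneg _) l ?_)
            (mul_le_of_le_one_left (by positivity) hw)
          rintro rfl
          simp [layer, dlayer]
      _ ≤ M * (E * ‖θ' - θ‖ ^ 2) + ‖θ' - θ‖ * (B * ‖θ' - θ‖) := by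
          gcongr
          exact ih m θ θ' x hl hθ hθ' hx
      _ = _ := by ring

/-- The network is Lipschitz on tame parameters, uniformly in the width. -/
theorem exists_net_sub_le {R M : ℝ} (hφ : Differentiable ℝ φ)
    (hβ : ∀ u, |deriv φ u| ≤ β) (hR : 0 ≤ R) (hM : 0 ≤ M) (L d : ℕ) :
    ∃ G, 0 ≤ G ∧ ∀ (m : ℕ) (θ θ' : Param L d m) (x : EuclideanSpace ℝ (Fin d)),
      1 ≤ m → 1 ≤ L → Tame M θ → Tame M θ' → ‖x‖ ≤ R →
      |net φ θ' x - net φ θ x| ≤ G * ‖θ' - θ‖ := by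
  obtain ⟨A, hA, hlayer⟩ := exists_l2_layer_le hφ hβ hR hM L d L
  obtain ⟨B, hB, hdiff⟩ := exists_l2_layer_sub_le hφ hβ hR hM L d L
  refine ⟨A + M * B, by positivity, fun m θ θ' x hm hL hθ hθ' hx => ?_⟩
  have hlay := (hdiff m θ θ' x hθ hθ' hx).2 le_rfl
  have hlayer := hlayer m θ' x le_rfl hθ' hx
  have hw : 1 ≤ √(width d m L : ℝ) := by
    obtain ⟨k, rfl⟩ : ∃ k, L = k + 1 := ⟨L - 1, by omega⟩
    exact Real.one_le_sqrt.2 (by exact_mod_cast hm)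
  have hw0 : 0 < √(width d m L : ℝ) := by linarith
  have h1 : net φ θ' x - net φ θ x = (outVec (θ' - θ) ⬝ᵥ layer φ θ' x L le_rfl +
      outVec θ ⬝ᵥ (layer φ θ' x L le_rfl - layer φ θ x L le_rfl)) / √(width d m L : ℝ) := by
    rw [net_eq, net_eq, outVec_sub, sub_dotProduct, dotProduct_sub]
    ring
  rw [h1, abs_div, abs_of_pos hw0, div_le_iff₀ hw0]
  calc _ ≤ ‖θ' - θ‖ * (A * √(width d m L : ℝ)) + M * (B * ‖θ' - θ‖) := by
        refine (abs_add_le _ _).trans (add_le_add ?_ ?_)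
        · exact (abs_dotProduct_le _ _).trans
            (mul_le_mul (l2_outVec_le _) hlayer (l2_nonneg _) (norm_nonneg _))
        · exact (abs_dotProduct_le _ _).trans (mul_le_mul hθ.2 hlay (l2_nonneg _) hM)
    _ ≤ ‖θ' - θ‖ * (A * √(width d m L : ℝ)) + M * (B * ‖θ' - θ‖) * √(width d m L : ℝ) := by
        exact add_le_add le_rfl (le_mul_of_one_le_right (by positivity) hw)
    _ = _ := by ring

/-- The network differs from its linearization by `O(1 / √m)` on tame parameters. -/
theorem exists_net_taylor_le {R M : ℝ} (hφ : Differentiable ℝ φ)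
    (hφ' : Differentiable ℝ (deriv φ)) (hβ : ∀ u, |deriv φ u| ≤ β ∧ |deriv (deriv φ) u| ≤ β)
    (hR : 0 ≤ R) (hM : 0 ≤ M) (L d : ℕ) :
    ∃ H, 0 ≤ H ∧ ∀ (m : ℕ) (θ θ' : Param L d m) (x : EuclideanSpace ℝ (Fin d)),
      1 ≤ L → Tame M θ → Tame M θ' → ‖x‖ ≤ R →
      |net φ θ' x - net φ θ x - fderiv ℝ (fun θ => net φ θ x) θ (θ' - θ)| ≤
        H * ‖θ' - θ‖ ^ 2 / √(m : ℝ) := by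
  obtain ⟨E, hE, htaylor⟩ := exists_l2_layer_taylor_le hφ hφ' hβ hR hM L d L
  obtain ⟨B, hB, hdiff⟩ := exists_l2_layer_sub_le hφ (fun u => (hβ u).1) hR hM L d L
  refine ⟨B + M * E, by positivity, fun m θ θ' x hL hθ hθ' hx => ?_⟩
  have hlay := (hdiff m θ θ' x hθ hθ' hx).2 le_rfl
  have htaylor := htaylor m θ θ' x le_rfl hθ hθ' hx
  have hw : √(width d m L : ℝ) = √(m : ℝ) := by
    obtain ⟨k, rfl⟩ : ∃ k, L = k + 1 := ⟨L - 1, by omega⟩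
    rfl
  have h1 : net φ θ' x - net φ θ x - dnet φ θ (θ' - θ) x =
      (outVec (θ' - θ) ⬝ᵥ (layer φ θ' x L le_rfl - layer φ θ x L le_rfl) +
      outVec θ ⬝ᵥ (layer φ θ' x L le_rfl - layer φ θ x L le_rfl -
        dlayer φ θ (θ' - θ) x L le_rfl)) / √(width d m L : ℝ) := by
    rw [net_eq, net_eq, dnet, outVec_sub]
    simp only [sub_dotProduct, dotProduct_sub]
    ring
  rw [fderiv_net hφ, h1, abs_div, abs_of_nonneg (Real.sqrt_nonneg _), hw]
  gcongr
  calc _ ≤ ‖θ' - θ‖ * (B * ‖θ' - θ‖) + M * (E * ‖θ' - θ‖ ^ 2) := by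
        refine (abs_add_le _ _).trans (add_le_add ?_ ?_)
        · exact (abs_dotProduct_le _ _).trans
            (mul_le_mul (l2_outVec_le _) hlay (l2_nonneg _) (norm_nonneg _))
        · exact (abs_dotProduct_le _ _).trans (mul_le_mul hθ.2 htaylor (l2_nonneg _) hM)
    _ = _ := by ring

end Bounds

end NeuralOGD

namespace NeuralOGD

/-! ### Online gradient descent under quadratic growth -/

open scoped RealInnerProductSpace

/-- A function whose second derivative is nonnegative between `p` and `q` lies above its tangent. -/
theorem tangent_le {g : ℝ → ℝ} (hg : Differentiable ℝ g) (hg' : Differentiable ℝ (deriv g))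
    {p q : ℝ} (h : ∀ u ∈ Set.uIcc p q, 0 ≤ deriv (deriv g) u) :
    g p + deriv g p * (q - p) ≤ g q := by
  have hmono : MonotoneOn (deriv g) (Set.uIcc p q) :=
    monotoneOn_of_deriv_nonneg (convex_uIcc p q) hg'.continuous.continuousOn hg'.differentiableOn
      fun x hx => h x (interior_subset hx)
  rcases lt_trichotomy p q with hpq | rfl | hpq
  · obtain ⟨ξ, hξ, hξ'⟩ := exists_deriv_eq_slope g hpq hg.continuous.continuousOn
      hg.differentiableOn
    have h1 := hmono Set.left_mem_uIcc (Set.Icc_subset_uIcc (Set.Ioo_subset_Icc_self hξ)) hξ.1.le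
    rw [hξ', le_div_iff₀ (by linarith)] at h1
    linarith
  · simp
  · obtain ⟨ξ, hξ, hξ'⟩ := exists_deriv_eq_slope g hpq hg.continuous.continuousOn
      hg.differentiableOn
    have h1 := hmono (Set.Icc_subset_uIcc' (Set.Ioo_subset_Icc_self hξ)) Set.left_mem_uIcc hξ.2.le
    rw [hξ', div_le_iff₀ (by linarith)] at h1
    linarith

theorem norm_gradient_eq {E : Type*} [NormedAddCommGroup E] [InnerProductSpace ℝ E]
    [CompleteSpace E] (f : E → ℝ) (x : E) : ‖∇ f x‖ = ‖fderiv ℝ f x‖ := by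
  rw [← toDual_gradient, LinearIsometryEquiv.norm_map]

/-- Uniqueness makes `θ'` the projection of every point, and the minimal value is dropped because it
is nonnegative. -/
theorem QuadraticGrowth.sq_dist_le {E : Type*} [NormedAddCommGroup E] {F : E → ℝ} {S : Set E}
    {μ : ℝ} (h : QuadraticGrowth F S μ) (h0 : ∀ θ, 0 ≤ F θ) {θ' : E} (hθ' : θ' ∈ argminSet F S)
    (huniq : ∀ θ'' ∈ argminSet F S, θ'' = θ') {θ : E} (hθ : θ ∈ S) :
    μ / 2 * ‖θ - θ'‖ ^ 2 ≤ F θ := by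
  by_cases hmin : θ ∈ argminSet F S
  · simp [huniq θ hmin, h0]
  · have := h θ ⟨hθ, hmin⟩ θ' hθ' fun θ'' h'' => by rw [huniq θ'' h'']
    linarith [h0 θ']

theorem sum_mul_sub_telescope (D : ℕ → ℝ) (T : ℕ) :
    ∑ t ∈ Finset.Icc 1 T, (t : ℝ) * (D t - D (t + 1)) =
      ∑ t ∈ Finset.Icc 1 T, D t - T * D (T + 1) := by
  induction T with
  | zero => simp
  | succ T ih =>
    rw [Finset.sum_Icc_succ_top (by omega), Finset.sum_Icc_succ_top (by omega), ih]
    push_cast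
    ring

theorem sum_one_div_le_log {T : ℕ} (hT : 2 ≤ T) :
    ∑ t ∈ Finset.Icc 1 T, 1 / (t : ℝ) ≤ 3 * Real.log T := by
  have h1 : (∑ t ∈ Finset.Icc 1 T, 1 / (t : ℝ)) = (harmonic T : ℝ) := by
    rw [harmonic_eq_sum_Icc]
    simp
  have h2 := harmonic_le_one_add_log T
  have h3 : Real.log 2 ≤ Real.log T := Real.log_le_log (by norm_num) (by exact_mod_cast hT)
  -- `1 + log T ≤ 3 log T` needs `log T ≥ 1/2`, which `T ≥ 2` provides.
  linarith [Real.log_two_gt_d9]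

/-- Regret of online gradient descent with steps `4 / (μ t)` for losses that are convex along the
run up to `ε` and satisfy a quadratic growth inequality. -/
theorem ogd_regret_le {E : Type*} [NormedAddCommGroup E] [InnerProductSpace ℝ E]
    [CompleteSpace E] {F : ℕ → E → ℝ} {T : ℕ} {θ : ℕ → E} {u : E} {μ G ε : ℝ} (hμ : 0 < μ)
    (hstep : IsOGD F (fun t => 4 / (μ * t)) T θ)
    (hgrad : ∀ t ∈ Finset.Icc 1 T, ‖∇ (F t) (θ t)‖ ≤ G)
    (hlin : ∀ t ∈ Finset.Icc 1 T, F t (θ t) + ⟪∇ (F t) (θ t), u - θ t⟫ - ε ≤ F t u)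
    (hqg : ∀ t ∈ Finset.Icc 1 T, μ / 8 * ‖θ t - u‖ ^ 2 ≤ (F t (θ t) + F t u) / 2) :
    ∑ t ∈ Finset.Icc 1 T, (F t (θ t) - F t u) ≤
      2 * ∑ t ∈ Finset.Icc 1 T, F t u + 4 * G ^ 2 / μ * ∑ t ∈ Finset.Icc 1 T, 1 / (t : ℝ) +
        2 * (T * ε) := by
  have hround : ∀ t ∈ Finset.Icc 1 T, F t (θ t) - F t u ≤
      ε + μ / 8 * (t * (‖θ t - u‖ ^ 2 - ‖θ (t + 1) - u‖ ^ 2)) + 2 * G ^ 2 / μ * (1 / t) := by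
    intro t ht
    have ht0 : (0 : ℝ) < t := by exact_mod_cast (Finset.mem_Icc.1 ht).1
    set g := ∇ (F t) (θ t) with hg
    have h1 : θ (t + 1) - u = (θ t - u) - (4 / (μ * t)) • g := by
      rw [hstep t ht]
      abel
    have h2 : ‖θ (t + 1) - u‖ ^ 2 = ‖θ t - u‖ ^ 2 - 2 * (4 / (μ * t) * ⟪g, θ t - u⟫) +
        (4 / (μ * t)) ^ 2 * ‖g‖ ^ 2 := by
      rw [h1, norm_sub_sq_real, real_inner_smul_right, real_inner_comm, norm_smul, mul_pow,
        Real.norm_eq_abs, sq_abs]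
    have h3 : ⟪g, u - θ t⟫ = -⟪g, θ t - u⟫ := by rw [← neg_sub, inner_neg_right]
    have h4 : μ / 8 * (t * (‖θ t - u‖ ^ 2 - ‖θ (t + 1) - u‖ ^ 2)) =
        -- The weight `μ t / 8` is `1 / (2 η_t)`; it grows by `μ / 8` per round, which is the
        -- coefficient in `hqg`.
        ⟪g, θ t - u⟫ - 2 * ‖g‖ ^ 2 / μ * (1 / t) := by
      rw [h2]
      field_simp
      ring
    have h5 : 2 * ‖g‖ ^ 2 / μ * (1 / t) ≤ 2 * G ^ 2 / μ * (1 / t) := by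
      have := hgrad t ht
      gcongr
    have h6 := hlin t ht
    rw [h3] at h6
    linarith
  have hsum := Finset.sum_le_sum hround
  have hq := Finset.sum_le_sum hqg
  simp only [Finset.sum_add_distrib, Finset.sum_sub_distrib, ← Finset.mul_sum,
    ← Finset.sum_div, Finset.sum_const, Nat.card_Icc, add_tsub_cancel_right,
    nsmul_eq_mul] at hsum hq ⊢
  have htel := sum_mul_sub_telescope (fun t => ‖θ t - u‖ ^ 2) T
  have hlast : 0 ≤ μ / 8 * (T * ‖θ (T + 1) - u‖ ^ 2) := by positivity
  have h4 : 4 * G ^ 2 / μ = 2 * (2 * G ^ 2 / μ) := by ring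
  rw [htel, mul_sub] at hsum
  rw [h4]
  linarith

/-! ### Gradient bound and approximate convexity of the batch loss -/

section Batch

variable {L d m : ℕ} {φ : ℝ → ℝ} {ℓ : ℝ → ℝ → ℝ} {lam a : ℝ} {B : Set (Param L d m)} {z : Batch d}

theorem LossAssumption.batchLoss_nonneg (h : LossAssumption φ ℓ lam a B z) (θ : Param L d m) :
    0 ≤ batchLoss φ ℓ z θ :=
  div_nonneg (Finset.sum_nonneg fun i _ => (h i).1 _) (Nat.cast_nonneg _)

theorem LossAssumption.fderiv_batchLoss (hφ : Differentiable ℝ φ)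
    (h : LossAssumption φ ℓ lam a B z) (θ : Param L d m) :
    fderiv ℝ (batchLoss φ ℓ z) θ = (z.size : ℝ)⁻¹ • ∑ i,
      deriv (ℓ (z.y i)) (net φ θ (z.x i)) • fderiv ℝ (fun θ => net φ θ (z.x i)) θ := by
  refine HasFDerivAt.fderiv ?_
  have h1 := (HasFDerivAt.fun_sum (u := Finset.univ) fun i _ =>
    ((h i).2.1 (net φ θ (z.x i))).hasDerivAt.comp_hasFDerivAt θ
      (differentiable_net hφ (z.x i) θ).hasFDerivAt).const_smul (z.size : ℝ)⁻¹
  refine h1.congr_of_eventuallyEq (Filter.Eventually.of_forall fun θ => ?_)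
  simp [batchLoss, div_eq_inv_mul]

theorem LossAssumption.norm_fderiv_batchLoss_le (hφ : Differentiable ℝ φ)
    (h : LossAssumption φ ℓ lam a B z) (hlam : 0 ≤ lam) {θ : Param L d m} (hθ : θ ∈ B) {G : ℝ}
    (hG : ∀ i, ‖fderiv ℝ (fun θ : Param L d m => net φ θ (z.x i)) θ‖ ≤ G) :
    ‖fderiv ℝ (batchLoss φ ℓ z) θ‖ ≤ lam * G := by
  have hn : (0 : ℝ) < z.size := by exact_mod_cast z.size_pos
  rw [h.fderiv_batchLoss hφ, norm_smul, norm_inv, Real.norm_natCast, inv_mul_le_iff₀ hn]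
  refine (norm_sum_le _ _).trans ((Finset.sum_le_card_nsmul _ _ (lam * G) fun i _ => ?_).trans ?_)
  · rw [norm_smul]
    exact mul_le_mul ((h i).2.2.2 θ hθ).1 (hG i) (norm_nonneg _) hlam
  · simp

/-- The batch loss is convex up to the linearization error of the network. -/
theorem LossAssumption.le_batchLoss (hφ : Differentiable ℝ φ)
    (h : LossAssumption φ ℓ lam a B z) (hlam : 0 ≤ lam) (ha : 0 ≤ a) (hB : IsPreconnected B)
    {θ θ' : Param L d m} (hθ : θ ∈ B) (hθ' : θ' ∈ B) {ε : ℝ}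
    (hε : ∀ i, |net φ θ' (z.x i) - net φ θ (z.x i) -
      fderiv ℝ (fun θ => net φ θ (z.x i)) θ (θ' - θ)| ≤ ε) :
    batchLoss φ ℓ z θ + fderiv ℝ (batchLoss φ ℓ z) θ (θ' - θ) - lam * ε ≤
      batchLoss φ ℓ z θ' := by
  have hn : (0 : ℝ) < z.size := by exact_mod_cast z.size_pos
  have hi : ∀ i, ℓ (z.y i) (net φ θ (z.x i)) + deriv (ℓ (z.y i)) (net φ θ (z.x i)) *
      fderiv ℝ (fun θ => net φ θ (z.x i)) θ (θ' - θ) - lam * ε ≤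
      ℓ (z.y i) (net φ θ' (z.x i)) := by
    intro i
    -- The curvature bound is assumed only at attained predictions. As `B` is connected, these form
    -- an interval, so it holds everywhere between the two predictions.
    have hord : ((fun θ => net φ θ (z.x i)) '' B).OrdConnected :=
      (hB.image _ (differentiable_net hφ (z.x i)).continuous.continuousOn).ordConnected
    have h1 := tangent_le (h i).2.1 (h i).2.2.1 (p := net φ θ (z.x i)) (q := net φ θ' (z.x i))
      fun u hu => by
        obtain ⟨θ'', h'', rfl⟩ := hord.uIcc_subset (Set.mem_image_of_mem _ hθ)
          (Set.mem_image_of_mem _ hθ') hu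
        exact ha.trans ((h i).2.2.2 θ'' h'').2
    have h2 := mul_le_mul ((h i).2.2.2 θ hθ).1 (hε i) (abs_nonneg _) hlam
    rw [← abs_mul] at h2
    linarith [neg_abs_le (deriv (ℓ (z.y i)) (net φ θ (z.x i)) * (net φ θ' (z.x i) -
      net φ θ (z.x i) - fderiv ℝ (fun θ => net φ θ (z.x i)) θ (θ' - θ)))]
  have hsum := Finset.sum_le_sum fun i (_ : i ∈ Finset.univ) => hi i
  simp only [Finset.sum_sub_distrib, Finset.sum_add_distrib, Finset.sum_const, Finset.card_univ,
    Fintype.card_fin, nsmul_eq_mul] at hsum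
  rw [h.fderiv_batchLoss hφ, batchLoss, batchLoss, le_div_iff₀ hn]
  simp only [smul_apply, sum_apply, smul_eq_mul]
  refine le_of_eq_of_le ?_ hsum
  field_simp

end Batch

/-- The deterministic half of the theorem: `C₁` and `C₂` are chosen before `m`. -/
theorem exists_regretBound_of_tame {L d : ℕ} (hL : 1 ≤ L) {φ : ℝ → ℝ} (hφ : SmoothActivation φ)
    {R ρ lam a μ M : ℝ} (hR : 0 ≤ R) (hρ : 0 < ρ) (hlam : 0 < lam) (ha : 0 < a) (hμ : 0 < μ)
    (hM : 0 ≤ M) :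
    ∃ C₁ C₂ : ℝ, ∀ m, 1 ≤ m → ∀ θ₀ : Param L d m, Tame M θ₀ →
      RegretBound φ R ρ lam a μ C₁ C₂ θ₀ := by
  obtain ⟨hφd, hφd', β, hβ⟩ := hφ
  -- The extra `1` keeps a neighbourhood of an iterate on the boundary of the ball tame, so that the
  -- Lipschitz bound controls the derivative there.
  have hM' : 0 ≤ M + (ρ + 1) := by positivity
  obtain ⟨G, hG, hLip⟩ := exists_net_sub_le hφd (fun u => (hβ u).1) hR hM' L d
  obtain ⟨H, hH, hTay⟩ := exists_net_taylor_le hφd hφd' hβ hR hM' L d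
  refine ⟨12 * (lam * G) ^ 2 / μ, 2 * (lam * (H * (2 * ρ) ^ 2)), fun m hm θ₀ hθ₀ => ?_⟩
  intro ℓ T z S θ u hT hx hloss hS hqg huniq hogd hθ hu
  have htame : ∀ θ', ‖θ' - θ₀‖ ≤ ρ + 1 → Tame (M + (ρ + 1)) θ' := fun θ' h =>
    hθ₀.of_norm_sub_le hm h
  have htame' : ∀ θ' ∈ Metric.closedBall θ₀ ρ, Tame (M + (ρ + 1)) θ' := fun θ' h =>
    htame θ' (by linarith [mem_closedBall_iff_norm.1 h])
  have key := ogd_regret_le (F := fun t => batchLoss φ ℓ (z t)) (u := u) (G := lam * G)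
    (ε := lam * (H * (2 * ρ) ^ 2 / √(m : ℝ))) hμ hogd (fun t ht => ?_) (fun t ht => ?_)
    fun t ht => ?_
  · have h1 := mul_le_mul_of_nonneg_left (sum_one_div_le_log hT)
      (show 0 ≤ 4 * (lam * G) ^ 2 / μ by positivity)
    have h2 : 2 * ((T : ℝ) * (lam * (H * (2 * ρ) ^ 2 / √(m : ℝ)))) =
        2 * (lam * (H * (2 * ρ) ^ 2)) * (T / √(m : ℝ)) := by ring
    have h3 : 12 * (lam * G) ^ 2 / μ * Real.log T =
        4 * (lam * G) ^ 2 / μ * (3 * Real.log T) := by ring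
    rw [h2] at key
    rw [h3]
    linarith
  · rw [norm_gradient_eq]
    refine (hloss t ht).norm_fderiv_batchLoss_le hφd hlam.le (hθ t ht) fun i => ?_
    refine norm_fderiv_le_of_lip' ℝ hG ?_
    filter_upwards [Metric.ball_mem_nhds (θ t) one_pos] with θ' h'
    refine hLip m (θ t) θ' _ hm hL (htame' _ (hθ t ht)) (htame _ ?_) (hx t ht i)
    have h1 := mem_closedBall_iff_norm.1 (hθ t ht)
    have h2 := mem_ball_iff_norm.1 h'
    have h3 := norm_sub_le_norm_sub_add_norm_sub θ' (θ t) θ₀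
    linarith
  · rw [inner_gradient_left]
    refine (hloss t ht).le_batchLoss hφd hlam.le ha.le (convex_closedBall θ₀ ρ).isPreconnected
      (hθ t ht) hu.1 fun i => ?_
    refine (hTay m (θ t) u _ hL (htame' _ (hθ t ht)) (htame' _ hu.1) (hx t ht i)).trans ?_
    gcongr
    have h1 := mem_closedBall_iff_norm.1 (hθ t ht)
    have h2 := mem_closedBall_iff_norm.1 hu.1
    have h3 := norm_sub_le_norm_sub_add_norm_sub u θ₀ (θ t)
    rw [norm_sub_rev θ₀] at h3
    linarith
  · obtain ⟨θ', hθ', huniq⟩ := huniq t ht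
    have h1 := (hqg t ht).sq_dist_le (hloss t ht).batchLoss_nonneg hθ' huniq (hS (hθ t ht))
    have h2 := (hqg t ht).sq_dist_le (hloss t ht).batchLoss_nonneg hθ' huniq (hS hu.1)
    have h3 := norm_sub_le_norm_sub_add_norm_sub (θ t) θ' u
    rw [norm_sub_rev θ' u] at h3
    have h4 : ‖θ t - u‖ ^ 2 ≤ 2 * (‖θ t - θ'‖ ^ 2 + ‖u - θ'‖ ^ 2) :=
      (pow_le_pow_left₀ (norm_nonneg _) h3 2).trans (add_sq_le)
    -- `μ/8 · 2 = μ/4` is half of the growth constant `μ/2`, so the average of `h1` and `h2`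
    -- suffices.
    nlinarith

/-! ### Tameness of the random initialization -/

section Initialization

open MeasureTheory ProbabilityTheory

/-- At a random initialization the weight matrices have operator norm `O(√m)`, except with
probability exponentially small in `m`. -/
theorem IsRandomInit.measure_not_tame_le {L d m : ℕ} (hm : 1 ≤ m) {Ω : Type*} [MeasurableSpace Ω]
    {P : Measure Ω} [IsProbabilityMeasure P] {θ₀ : Ω → Param L d m} (h : IsRandomInit P θ₀) :
    P {ω | ¬ Tame 13 (θ₀ ω)} ≤ ENNReal.ofReal (L * 5 ^ d * Real.exp (-(1 * m))) := by
  obtain ⟨hind, hlaw, hout⟩ := h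
  have hm0 : (0 : ℝ) < √(m : ℝ) := Real.sqrt_pos.2 (by exact_mod_cast hm)
  have hsub : {ω | ¬ Tame 13 (θ₀ ω)} ⊆
      (⋃ l : Fin L, {ω | ¬ OpBound (weight (θ₀ ω) l l.2) (13 * √(m : ℝ))}) ∪
        {ω | ¬ ∑ i : Fin (width d m L), θ₀ ω (Sum.inr i) ^ 2 = 1} := by
    intro ω hω
    by_contra hcon
    simp only [Set.mem_union, Set.mem_iUnion, Set.mem_ofPred_eq, not_or, not_exists,
      not_not] at hcon
    refine hω ⟨fun l hl => hcon.1 ⟨l, hl⟩, le_of_sq_le_sq ?_ (by norm_num)⟩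
    rw [l2_sq]
    exact hcon.2.le.trans (by norm_num)
  have hl : ∀ l : Fin L, P {ω | ¬ OpBound (weight (θ₀ ω) l l.2) (13 * √(m : ℝ))} ≤
      ENNReal.ofReal (5 ^ d * Real.exp (-(1 * m))) := by
    intro l
    have hinj : Function.Injective fun p : Fin (width d m (l.val + 1)) × Fin (width d m l.val) =>
        (⟨l, p⟩ : WeightIdx L d m) := fun p q hpq => by simpa using hpq
    refine (measure_not_opBound_le (hind.precomp hinj) (fun p => hlaw ⟨l, p⟩)
      (t := 13 * √(m : ℝ)) (by positivity)).trans (ENNReal.ofReal_le_ofReal ?_)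
    rw [Fintype.card_fin, Fintype.card_fin, mul_pow, Real.sq_sqrt (Nat.cast_nonneg m)]
    -- Covers the first layer as well, at the cost of `5 ^ d`. As `5 ≤ e²`, the nets cost at most `5
    -- ^ d e^{4m}`, and `13² / 32 ≥ 5` leaves `e^{-m}`.
    have hw : width d m l ≤ m + d := by
      cases l.val <;> simp [width]
    have h5 : (5 : ℝ) ≤ Real.exp 2 := by
      rw [show (2 : ℝ) = 1 + 1 by norm_num, Real.exp_add]
      nlinarith [Real.exp_one_gt_d9]
    calc (5 : ℝ) ^ (width d m (l.val + 1) + width d m l.val) * Real.exp (-(13 ^ 2 * m) / 32)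
        ≤ 5 ^ (d + (m + m)) * Real.exp (-(13 ^ 2 * m) / 32) := by
          refine mul_le_mul_of_nonneg_right (pow_le_pow_right₀ (by norm_num) ?_)
            (Real.exp_nonneg _)
          change m + _ ≤ _
          omega
      _ ≤ 5 ^ d * Real.exp 2 ^ (m + m) * Real.exp (-(13 ^ 2 * m) / 32) := by
          rw [pow_add]
          gcongr
      _ ≤ 5 ^ d * Real.exp (-(1 * m)) := by
          rw [mul_assoc, ← Real.exp_nat_mul, ← Real.exp_add]
          gcongr
          push_cast
          linarith [(Nat.cast_nonneg m : (0 : ℝ) ≤ m)]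
  refine (measure_mono hsub).trans ((measure_union_le _ _).trans ?_)
  rw [show P {ω | ¬ ∑ i : Fin (width d m L), θ₀ ω (Sum.inr i) ^ 2 = 1} = 0 from hout, add_zero]
  refine (measure_iUnion_fintype_le _ _).trans ((Finset.sum_le_sum fun l _ => hl l).trans ?_)
  rw [Finset.sum_const, Finset.card_univ, Fintype.card_fin, nsmul_eq_mul, mul_assoc,
    ENNReal.ofReal_mul (Nat.cast_nonneg L), ENNReal.ofReal_natCast]

end Initialization

end NeuralOGD

theorem mainTheorem1 (L d : ℕ) (hL : 1 ≤ L) (φ : ℝ → ℝ) (hφ : NeuralOGD.SmoothActivation φ)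
    (R ρ lam a μ : ℝ) (hR : 0 ≤ R) (hρ : 0 < ρ) (hlam : 0 < lam) (ha : 0 < a) (hμ : 0 < μ) :
    ∃ C₁ C₂ K c : ℝ, 0 < c ∧
      ∀ (m : ℕ), 1 ≤ m →
      ∀ (Ω : Type*) [MeasurableSpace Ω] (P : MeasureTheory.Measure Ω)
        [MeasureTheory.IsProbabilityMeasure P] (θ₀ : Ω → NeuralOGD.Param L d m),
        NeuralOGD.IsRandomInit P θ₀ →
        P {ω | ¬ NeuralOGD.RegretBound φ R ρ lam a μ C₁ C₂ (θ₀ ω)} ≤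
          ENNReal.ofReal (K * Real.exp (-(c * m))) := by
  obtain ⟨C₁, C₂, h⟩ := NeuralOGD.exists_regretBound_of_tame (d := d) hL hφ hR hρ hlam ha hμ
    (M := 13) (by norm_num)
  refine ⟨C₁, C₂, L * 5 ^ d, 1, one_pos, fun m hm Ω _ P _ θ₀ hθ₀ => ?_⟩
  have hsub : {ω | ¬ NeuralOGD.RegretBound φ R ρ lam a μ C₁ C₂ (θ₀ ω)} ⊆
      {ω | ¬ NeuralOGD.Tame 13 (θ₀ ω)} := fun ω hω hω' => hω (h m hm _ hω')
  exact (MeasureTheory.measure_mono hsub).trans (hθ₀.measure_not_tame_le hm)
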